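/- Let $n \ge 3$ and let $C_n$ be the cycle with $n$ vertices. In the Toucher–Isolator game on a finite graph $G$, two players, Toucher and Isolator, alternately claim previously unclaimed edges of $G$, Toucher moving first, until every edge has been claimed. A vertex is untouched if, at the end of the game, it is incident to no edge claimed by Toucher. Toucher aims to minimise the number of untouched vertices and Isolator aims to maximise it; let $u(G)$ be the number of untouched vertices when both players play optimally (the minimax value of the game). Then $$u(C_n) = \left\lfloor \frac{n+1}{5} \right\rfloor .$$ -/

import Mathlib

/-- The two players of the Toucher-Isolator game. -/
inductive Player where
  | toucher
  | isolator

/-- The vertices that are incident to no edge of `T`, the set of edges claimed by Toucher. -/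
def untouchedVertices {V : Type*} [Fintype V] [DecidableEq V] (T : Finset (Sym2 V)) : Finset V :=
  Finset.univ.filter fun v => ∀ e ∈ T, v ∉ e

/-- The minimax value of a position of the Toucher-Isolator game. In the position, `T` is the set
of edges already claimed by Toucher, `A` is the set of edges not yet claimed by anybody, and the
first argument is the player to move. When every edge has been claimed, the outcome is the number
of untouched vertices; otherwise the player to move claims an edge of `A`, Toucher minimising and
Isolator maximising the outcome. -/
def positionValue {V : Type*} [Fintype V] [DecidableEq V] :
    Player → Finset (Sym2 V) → Finset (Sym2 V) → ℕ
  | .toucher, T, A =>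
    if h : A.Nonempty then
      A.attach.inf' h.attach fun e => positionValue .isolator (insert e.1 T) (A.erase e.1)
    else (untouchedVertices T).card
  | .isolator, T, A =>
    if h : A.Nonempty then
      A.attach.sup' h.attach fun e => positionValue .toucher T (A.erase e.1)
    else (untouchedVertices T).card
termination_by _ _ A => A.card
decreasing_by
  all_goals exact Finset.card_erase_lt_of_mem e.2

/-- `u(G)`: the number of untouched vertices at the end of the Toucher-Isolator game on `G`, with
Toucher moving first and both players playing optimally. -/
def untouchedNumber {V : Type*} [Fintype V] [DecidableEq V] (G : SimpleGraph V)
    [DecidableRel G.Adj] : ℕ :=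
  positionValue .toucher ∅ G.edgeFinset

/-! After Toucher's first claim the other edges form a line of cells between Toucher claims, and
untouched vertices are adjacent pairs of Isolator cells. A claim cuts a run of free cells into two
independent runs, so a position is a sum of scoring games, one per `Segment`.

Each segment has a mean value `weight / 8`, which grows by one point per five cells. A claim gains
its player at most 7 eighths, or 8 if it changes the parity of the number of critical segments
(`weight_toucher_split`, `weight_isolator_split`). Critical segments cancel in pairs, so only their
parity matters. The value of a position is thus the total mean, shifted by one eighth against the
opponent of the mover when that parity is odd: up and rounded up if Isolator moves, down and rounded
down if Toucher moves.

That this rounding can be achieved rests on temperature: some segment offers both players a gain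
large enough to reach the next integer (`exists_heat`, `exists_toucher_split`,
`exists_isolator_split`). Induction on the free edges gives `positionValue_eq`. On the cycle one
segment of `n - 1` cells remains, and `weightTT (n - 1) / 8` rounds up to the claimed value. -/

/-- A maximal run of unclaimed cells, with the claims on its two sides; `true` is Isolator. -/
structure Segment where
  left : Bool
  length : ℕ
  right : Bool

/-! ### Mean values of segments, and bounds on the gain from one claim -/

namespace Segment

/-- Eight times the mean value of a segment bordered by Toucher on both sides. -/
def weightTT (l : ℕ) : ℕ := 4 * ((l + 2) / 5) + 2 * (l / 5) + 2 * ((l + 4) / 5) - 2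

/-- Eight times the mean value of a segment bordered by Toucher on exactly one side. -/
def weightTI (l : ℕ) : ℕ :=
  2 * ((l + 4) / 5) + 2 * ((l + 3) / 5) + (l + 2) / 5 + (l + 1) / 5 + 2 * (l / 5) + 2 * min l 1

/-- Eight times the mean value of a segment, regarded as a scoring game. -/
def weight : Segment → ℕ
  | ⟨false, l, false⟩ => weightTT l
  | ⟨true, l, true⟩ => 8 + weightTI (l - 2)
  | ⟨_, l, _⟩ => weightTI l

/-- Whether the segment is a single cell between two claims of Isolator. -/
def critical : Segment → ℕ
  | ⟨true, 1, true⟩ => 1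
  | _ => 0

/-- The points that a segment without unclaimed cells is worth. -/
def score : Segment → ℕ
  | ⟨true, 0, true⟩ => 1
  | _ => 0

/-- The residues run from 1 to 5 because length 0 is exceptional: both weights are periodic up to a
shift by 8 only from length 1 on. -/
theorem eq_zero_or_residue (l : ℕ) : l = 0 ∨ ∃ a, l = 5 * a + 1 ∨ l = 5 * a + 2 ∨ l = 5 * a + 3 ∨
    l = 5 * a + 4 ∨ l = 5 * a + 5 := by
  rcases l with _ | l
  · simp
  · exact .inr ⟨l / 5, by omega⟩

theorem weightTT_residue (a : ℕ) : weightTT (5 * a + 1) = 8 * a ∧ weightTT (5 * a + 2) = 8 * a ∧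
    weightTT (5 * a + 3) = 8 * a + 4 ∧ weightTT (5 * a + 4) = 8 * a + 4 ∧
    weightTT (5 * a + 5) = 8 * a + 6 := by
  unfold weightTT
  omega

theorem weightTI_zero : weightTI 0 = 0 := rfl

theorem weightTI_residue (a : ℕ) : weightTI (5 * a + 1) = 8 * a + 4 ∧
    weightTI (5 * a + 2) = 8 * a + 6 ∧ weightTI (5 * a + 3) = 8 * a + 7 ∧
    weightTI (5 * a + 4) = 8 * a + 8 ∧ weightTI (5 * a + 5) = 8 * a + 10 := by
  unfold weightTI
  omega

theorem critical_eq_zero {s : Segment} (h : s.left = false ∨ s.right = false) :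
    s.critical = 0 := by
  rcases s with ⟨_ | _, _ | _ | l, _ | _⟩ <;> simp_all [critical]

theorem critical_true (l : ℕ) : critical ⟨true, l, true⟩ = if l = 1 then 1 else 0 := by
  rcases l with _ | _ | l <;> simp [critical]

theorem critical_le_one (s : Segment) : s.critical ≤ 1 := by
  rcases s with ⟨_ | _, _ | _ | l, _ | _⟩ <;> simp [critical]

theorem weightTT_add_five {l : ℕ} (hl : 1 ≤ l) : weightTT (l + 5) = weightTT l + 8 := by
  unfold weightTT
  omega

theorem weightTI_add_five {l : ℕ} (hl : 1 ≤ l) : weightTI (l + 5) = weightTI l + 8 := by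
  unfold weightTI
  omega

/-- Reduces inequalities between weights to 64 decidable cases. The bound 3 in the steps keeps `p -
2` and `q - 2` at least 1, where the weights are periodic. -/
theorem induction_by_fives {P : ℕ → ℕ → Prop} (base : ∀ p < 8, ∀ q < 8, P p q)
    (left : ∀ p q, 3 ≤ p → P p q → P (p + 5) q) (right : ∀ p q, 3 ≤ q → P p q → P p (q + 5))
    (p q : ℕ) : P p q := by
  have h1 (p : ℕ) (hp : p < 8) (q : ℕ) : P p q := by
    induction q using Nat.strong_induction_on with
    | _ q ih =>
      by_cases hq : q < 8
      · exact base p hp q hq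
      · have := right p (q - 5) (by omega) (ih (q - 5) (by omega))
        rwa [Nat.sub_add_cancel (by omega)] at this
  induction p using Nat.strong_induction_on with
  | _ p ih =>
    by_cases hp : p < 8
    · exact h1 p hp q
    · have := left (p - 5) q (by omega) (ih (p - 5) (by omega))
      rwa [Nat.sub_add_cancel (by omega)] at this

theorem weightTT_split (p q : ℕ) :
    weightTT (p + 1 + q) ≤ weightTT p + weightTT q + 7 ∧
      weightTI (p + 1 + q) ≤ weightTT p + weightTI q + 7 ∧
      weightTI p + weightTI q ≤ weightTT (p + 1 + q) + 7 := by
  induction p, q using induction_by_fives with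
  | base => decide +revert
  | left p q hp ih =>
    rw [show p + 5 + 1 + q = p + 1 + q + 5 by omega, weightTT_add_five (by omega),
      weightTI_add_five (by omega), weightTT_add_five (by omega), weightTI_add_five (by omega)]
    omega
  | right p q hq ih =>
    rw [show p + 1 + (q + 5) = p + 1 + q + 5 by omega, weightTT_add_five (by omega),
      weightTI_add_five (by omega), weightTT_add_five (by omega), weightTI_add_five (by omega)]
    omega

theorem weightTI_split_of_toucher (p q : ℕ) (h : p + q ≠ 0) :
    8 + weightTI (p + 1 + q - 2) ≤ weightTI p + weightTI q + 7 := by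
  induction p, q using induction_by_fives with
  | base => decide +revert
  | left p q hp ih =>
    rw [show p + 5 + 1 + q - 2 = p + 1 + q - 2 + 5 by omega, weightTI_add_five (by omega),
      weightTI_add_five (by omega)]
    have := ih (by omega)
    omega
  | right p q hq ih =>
    rw [show p + 1 + (q + 5) - 2 = p + 1 + q - 2 + 5 by omega, weightTI_add_five (by omega),
      weightTI_add_five (by omega)]
    have := ih (by omega)
    omega

theorem weightTI_split_of_isolator (p q : ℕ) :
    weightTI p + (8 + weightTI (q - 2)) ≤ weightTI (p + 1 + q) + 7 + if q = 1 then 1 else 0 := by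
  induction p, q using induction_by_fives with
  | base => decide +revert
  | left p q hp ih =>
    rw [show p + 5 + 1 + q = p + 1 + q + 5 by omega, weightTI_add_five (by omega),
      weightTI_add_five (by omega)]
    omega
  | right p q hq ih =>
    rw [show p + 1 + (q + 5) = p + 1 + q + 5 by omega, show q + 5 - 2 = q - 2 + 5 by omega,
      weightTI_add_five (by omega), weightTI_add_five (by omega), if_neg (by omega)]
    rw [if_neg (by omega)] at ih
    omega

theorem weightTI_sub_split (p q : ℕ) :
    8 + weightTI (p - 2) + weightTI (q - 2) ≤ weightTI (p + 1 + q - 2) + 7 +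
      ((if p + 1 + q = 1 then 1 else 0) + (if p = 1 then 1 else 0) +
        if q = 1 then 1 else 0) % 2 := by
  induction p, q using induction_by_fives with
  | base => decide +revert
  | left p q hp ih =>
    rw [show p + 5 + 1 + q - 2 = p + 1 + q - 2 + 5 by omega,
      show p + 5 - 2 = p - 2 + 5 by omega,
      weightTI_add_five (by omega), weightTI_add_five (by omega), if_neg (by omega),
      if_neg (by omega)]
    rw [if_neg (by omega), if_neg (by omega)] at ih
    omega
  | right p q hq ih =>
    rw [show p + 1 + (q + 5) - 2 = p + 1 + q - 2 + 5 by omega,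
      show q + 5 - 2 = q - 2 + 5 by omega,
      weightTI_add_five (by omega), weightTI_add_five (by omega), if_neg (by omega),
      if_neg (c := q + 5 = 1) (by omega)]
    rw [if_neg (by omega), if_neg (c := q = 1) (by omega)] at ih
    omega

theorem weight_toucher_split (x y : Bool) (p q : ℕ) :
    weight ⟨x, p + 1 + q, y⟩ ≤ weight ⟨x, p, false⟩ + weight ⟨false, q, y⟩ + 7 +
      critical ⟨x, p + 1 + q, y⟩ := by
  cases x <;> cases y <;>
    simp only [weight, critical_true, critical_eq_zero (s := ⟨false, _, _⟩) (.inl rfl),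
      critical_eq_zero (s := ⟨_, _, false⟩) (.inr rfl)]
  · exact (weightTT_split p q).1
  · exact (weightTT_split p q).2.1
  · have := (weightTT_split q p).2.1
    rw [show q + 1 + p = p + 1 + q by omega] at this
    omega
  · by_cases h : p + q = 0
    · obtain ⟨rfl, rfl⟩ : p = 0 ∧ q = 0 := by omega
      simp [weightTI]
    · have := weightTI_split_of_toucher p q h
      omega

/-- The last term is 1 exactly when the claim changes the parity of the number of critical segments.
-/
theorem weight_isolator_split (x y : Bool) (p q : ℕ) :
    weight ⟨x, p, true⟩ + weight ⟨true, q, y⟩ ≤ weight ⟨x, p + 1 + q, y⟩ + 7 +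
      (critical ⟨x, p + 1 + q, y⟩ + critical ⟨x, p, true⟩ + critical ⟨true, q, y⟩) % 2 := by
  cases x <;> cases y <;>
    simp only [weight, critical_true, critical_eq_zero (s := ⟨false, _, _⟩) (.inl rfl),
      critical_eq_zero (s := ⟨_, _, false⟩) (.inr rfl)]
  · exact (weightTT_split p q).2.2
  · have := weightTI_split_of_isolator p q
    split_ifs at this ⊢ <;> omega
  · have := weightTI_split_of_isolator q p
    rw [show q + 1 + p = p + 1 + q by omega] at this
    split_ifs at this ⊢ <;> omega
  · have := weightTI_sub_split p q
    omega

/-! ### Temperatures and good claims -/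

/-- The temperature that a weight forces, in eighths. -/
def heat (m : ℕ) : ℕ :=
  if m % 2 = 1 then 7 else if m % 4 = 2 then 6 else if m % 8 = 4 then 4 else 0

theorem heat_mul_add (a c : ℕ) : heat (8 * a + c) = heat c := by
  unfold heat
  split_ifs <;> omega

theorem heat_mul (a : ℕ) : heat (8 * a) = 0 := heat_mul_add a 0

theorem heat_values : heat 0 = 0 ∧ heat 4 = 4 ∧ heat 6 = 6 ∧ heat 7 = 7 ∧ heat 8 = 0 ∧
    heat 10 = 6 := by decide

theorem heat_eight_add (c : ℕ) : heat (8 + c) = heat c := heat_mul_add 1 c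

/-- Both players claim the cell next to Isolator's border: Toucher leaves a run between Toucher
claims, Isolator scores a point and keeps the same type of run. -/
theorem heat_weightTI (l : ℕ) (hl : l ≠ 0) :
    weightTT (l - 1) + heat (weightTI l) ≤ weightTI l ∧
      weightTI l + heat (weightTI l) ≤ 8 + weightTI (l - 1) := by
  have hv := heat_values
  rcases eq_zero_or_residue l with rfl | ⟨a, h⟩
  · simp at hl
  have hI := weightTI_residue a
  have hT := weightTT_residue a
  rcases h with rfl | rfl | rfl | rfl | rfl
  · rcases a with _ | a
    · decide
    · have hI' := weightTI_residue a
      have hT' := weightTT_residue a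
      simp only [show 5 * (a + 1) + 1 - 1 = 5 * a + 5 by omega, hI, hI', hT', heat_mul_add, hv]
      omega
  all_goals
    simp only [Nat.add_succ_sub_one, hI, hT, heat_mul_add, hv]
    omega

/-- Both claim an end cell of a run between Isolator claims. The extra term pays for the critical
segment that Isolator creates when `l = 2`. -/
theorem heat_weightTI_sub (l : ℕ) (hl : 2 ≤ l) :
    weightTI (l - 1) + heat (weightTI (l - 2)) ≤ 8 + weightTI (l - 2) ∧
      weightTI (l - 2) + heat (weightTI (l - 2)) + (if l - 1 = 1 then 1 else 0) ≤
        8 + weightTI (l - 3) := by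
  have hv := heat_values
  obtain ⟨m, rfl⟩ : ∃ m, l = m + 2 := ⟨l - 2, by omega⟩
  rw [show m + 2 - 1 = m + 1 by omega, show m + 2 - 2 = m by omega,
    show m + 2 - 3 = m - 1 by omega]
  rcases Nat.eq_zero_or_pos m with rfl | hm
  · decide
  · have h1 := (heat_weightTI m (by omega)).2
    rw [if_neg (by omega)]
    refine ⟨?_, h1⟩
    rcases eq_zero_or_residue m with rfl | ⟨a, h⟩
    · simp at hm
    have hI := weightTI_residue a
    have hI' := weightTI_residue (a + 1)
    rcases h with rfl | rfl | rfl | rfl | rfl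
    case inr.inr.inr.inr.inr.inr =>
      rw [show 5 * a + 5 + 1 = 5 * (a + 1) + 1 by omega]
      simp only [hI, hI', heat_mul_add, hv]
      omega
    all_goals
      simp only [Nat.add_assoc, Nat.reduceAdd, hI, heat_mul_add, hv]
      omega

/-- Between Toucher claims the good cell is the third from a border. At `l = 3` this gains Isolator
too little; the middle cell is used there instead. -/
theorem heat_weightTT (l : ℕ) (hl : 3 ≤ l) :
    weightTT 2 + weightTT (l - 3) + heat (weightTT l) ≤ weightTT l ∧
      (l ≠ 3 → weightTT l + heat (weightTT l) ≤ weightTI 2 + weightTI (l - 3)) := by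
  have hv := heat_values
  rcases eq_zero_or_residue l with rfl | ⟨a, h⟩
  · simp at hl
  have hT := weightTT_residue a
  have h2 : weightTT 2 = 0 ∧ weightTI 2 = 6 := by decide
  rcases h with rfl | rfl | rfl | rfl | rfl
  · simp only [hT, heat_mul, h2]
    unfold weightTT weightTI
    omega
  · simp only [hT, heat_mul, h2]
    unfold weightTT weightTI
    omega
  all_goals
    simp only [hT, heat_mul_add, hv, h2]
    unfold weightTT weightTI
    omega

theorem eq_of_critical {x y : Bool} {l : ℕ} (h : critical ⟨x, l, y⟩ = 1) :
    l = 1 ∧ x = true ∧ y = true := by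
  rcases x <;> rcases y <;> simp_all [critical_true, critical_eq_zero]

theorem exists_toucher_split (x y : Bool) (l : ℕ) (hl : l ≠ 0) :
    ∃ p q, l = p + 1 + q ∧
      weight ⟨x, p, false⟩ + weight ⟨false, q, y⟩ + heat (weight ⟨x, l, y⟩) ≤ weight ⟨x, l, y⟩ ∧
      (critical ⟨x, l, y⟩ = 1 →
        weight ⟨x, p, false⟩ + weight ⟨false, q, y⟩ + 8 = weight ⟨x, l, y⟩) := by
  cases x
  · cases y
    · by_cases h : l ≤ 2
      · refine ⟨0, l - 1, by omega, ?_, fun h => by simpa using eq_of_critical h⟩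
        obtain rfl | rfl : l = 1 ∨ l = 2 := by omega
        all_goals decide
      · refine ⟨2, l - 3, by omega, ?_, fun h => by simpa using eq_of_critical h⟩
        exact (heat_weightTT l (by omega)).1
    · refine ⟨l - 1, 0, by omega, ?_, fun h => by simpa using eq_of_critical h⟩
      exact (heat_weightTI l hl).1
  · cases y
    · refine ⟨0, l - 1, by omega, ?_, fun h => by simpa using eq_of_critical h⟩
      simpa [weight, weightTI_zero] using (heat_weightTI l hl).1
    · by_cases h : l = 1
      · subst h
        exact ⟨0, 0, by decide⟩
      · refine ⟨0, l - 1, by omega, ?_, fun h' => absurd (eq_of_critical h').1 h⟩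
        simpa [weight, weightTI_zero, heat_eight_add] using
          (heat_weightTI_sub l (by omega)).1

theorem exists_isolator_split (x y : Bool) (l : ℕ) (hl : l ≠ 0) :
    ∃ p q, l = p + 1 + q ∧
      weight ⟨x, l, y⟩ + heat (weight ⟨x, l, y⟩) + critical ⟨x, p, true⟩ + critical ⟨true, q, y⟩ ≤
        weight ⟨x, p, true⟩ + weight ⟨true, q, y⟩ ∧
      (critical ⟨x, l, y⟩ = 1 →
        weight ⟨x, p, true⟩ + weight ⟨true, q, y⟩ = weight ⟨x, l, y⟩ + 8 ∧
        critical ⟨x, p, true⟩ = 0 ∧ critical ⟨true, q, y⟩ = 0) := by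
  cases x
  · cases y
    · by_cases h : l ≤ 3
      · obtain rfl | rfl | rfl : l = 1 ∨ l = 2 ∨ l = 3 := by omega
        · exact ⟨0, 0, by decide⟩
        · exact ⟨0, 1, by decide⟩
        · exact ⟨1, 1, by decide⟩
      · refine ⟨2, l - 3, by omega, ?_, fun h => by simpa using eq_of_critical h⟩
        simpa [critical_eq_zero, weight] using (heat_weightTT l (by omega)).2 (by omega)
    · refine ⟨l - 1, 0, by omega, ?_, fun h => by simpa using eq_of_critical h⟩
      have := (heat_weightTI l hl).2
      simp only [weight, critical_true, critical_eq_zero (s := ⟨false, _, _⟩) (.inl rfl)]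
      simp
      omega
  · cases y
    · refine ⟨0, l - 1, by omega, ?_, fun h => by simpa using eq_of_critical h⟩
      have := (heat_weightTI l hl).2
      simp only [weight, critical_true, critical_eq_zero (s := ⟨_, _, false⟩) (.inr rfl)]
      simpa [weightTI_zero]
    · by_cases h : l = 1
      · subst h
        exact ⟨0, 0, by decide⟩
      · refine ⟨0, l - 1, by omega, ?_, fun h' => absurd (eq_of_critical h').1 h⟩
        have := (heat_weightTI_sub l (by omega)).2
        simp only [weight, critical_true, heat_eight_add, Nat.sub_sub, Nat.zero_sub,
          weightTI_zero, if_neg zero_ne_one] at this ⊢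
        simp only [Nat.reduceAdd]
        omega

/-! ### Sums of segments: no claim beats the rounded value, and some claim attains it -/

/-- The total weight of a list of segments. -/
def total (S : List Segment) : ℕ := (S.map weight).sum

/-- The number of critical segments. -/
def criticals (S : List Segment) : ℕ := (S.map critical).sum

/-- The value of a list of segments with Isolator to move. -/
def isolatorValue (S : List Segment) : ℕ := (total S + criticals S % 2 + 7) / 8

/-- The value of a list of segments with Toucher to move. -/
def toucherValue (S : List Segment) : ℕ := (total S - criticals S % 2) / 8

/-- `Split c S S'`: a claim of `c` somewhere inside a segment turns `S` into `S'`. -/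
def Split (c : Bool) (S S' : List Segment) : Prop :=
  ∃ pre suf x p q y, S = pre ++ ⟨x, p + 1 + q, y⟩ :: suf ∧
    S' = pre ++ ⟨x, p, c⟩ :: ⟨c, q, y⟩ :: suf

theorem total_split (pre suf : List Segment) (s : Segment) :
    total (pre ++ s :: suf) = total pre + s.weight + total suf := by
  simp [total, add_assoc]

theorem total_cons (s : Segment) (S : List Segment) : total (s :: S) = s.weight + total S := by
  simp [total]

theorem criticals_split (pre suf : List Segment) (s : Segment) :
    criticals (pre ++ s :: suf) = criticals pre + s.critical + criticals suf := by
  simp [criticals, add_assoc]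

theorem criticals_cons (s : Segment) (S : List Segment) :
    criticals (s :: S) = s.critical + criticals S := by
  simp [criticals]

theorem exists_critical {S : List Segment} (h : criticals S % 2 = 1) :
    ∃ s ∈ S, s.critical = 1 := by
  by_contra! H
  have : criticals S = 0 := by
    refine List.sum_eq_zero ?_
    simp only [List.mem_map]
    rintro _ ⟨s, hs, rfl⟩
    have := H s hs
    have := critical_le_one s
    omega
  omega

theorem length_ne_zero_of_critical {s : Segment} (h : s.critical = 1) : s.length ≠ 0 := by
  rcases s with ⟨_ | _, _ | _ | l, _ | _⟩ <;> simp_all [critical]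

theorem length_ne_zero_of_weight {s : Segment} (h : s.weight % 8 ≠ 0) : s.length ≠ 0 := by
  rcases s with ⟨_ | _, _ | l, _ | _⟩ <;> simp_all [weight, weightTI, weightTT]

/-- Some segment is hot enough to absorb the residue of the total weight. -/
theorem exists_heat {S : List Segment} (h : total S % 8 ≠ 0) :
    ∃ s ∈ S, s.length ≠ 0 ∧ total S % 8 ≤ heat s.weight ∧ 8 ≤ total S % 8 + heat s.weight := by
  -- The segment to choose has a weight with the fewest factors 2: the total inherits its
  -- divisibility, so the residue stays within the range that its heat covers.
  have dvd (k : ℕ) (H : ∀ s ∈ S, k ∣ s.weight) : k ∣ total S := by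
    refine List.dvd_sum ?_
    simpa using H
  by_cases h2 : ∀ s ∈ S, 2 ∣ s.weight
  · have d2 := dvd 2 h2
    by_cases h4 : ∀ s ∈ S, 4 ∣ s.weight
    · have d4 := dvd 4 h4
      by_cases h8 : ∀ s ∈ S, 8 ∣ s.weight
      · have := dvd 8 h8
        omega
      · push Not at h8
        obtain ⟨s, hs, hw⟩ := h8
        have := h4 s hs
        refine ⟨s, hs, length_ne_zero_of_weight (by omega), ?_⟩
        have : heat s.weight = 4 := by unfold heat; split_ifs <;> omega
        omega
    · push Not at h4
      obtain ⟨s, hs, hw⟩ := h4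
      have := h2 s hs
      refine ⟨s, hs, length_ne_zero_of_weight (by omega), ?_⟩
      have : heat s.weight = 6 := by unfold heat; split_ifs <;> omega
      omega
  · push Not at h2
    obtain ⟨s, hs, hw⟩ := h2
    refine ⟨s, hs, length_ne_zero_of_weight (by omega), ?_⟩
    have : heat s.weight = 7 := by unfold heat; split_ifs <;> omega
    omega

theorem Split.toucherValue_le {S S' : List Segment} (h : Split false S S') :
    toucherValue S ≤ isolatorValue S' := by
  obtain ⟨pre, suf, x, p, q, y, rfl, rfl⟩ := h
  have hw := weight_toucher_split x y p q
  have h1 := critical_eq_zero (s := ⟨x, p, false⟩) (.inr rfl)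
  have h2 := critical_eq_zero (s := ⟨false, q, y⟩) (.inl rfl)
  have h3 := critical_le_one ⟨x, p + 1 + q, y⟩
  simp only [toucherValue, isolatorValue, total_split, criticals_split, total_cons,
    criticals_cons, h1, h2]
  omega

theorem Split.toucherValue_le_isolatorValue {S S' : List Segment} (h : Split true S S') :
    toucherValue S' ≤ isolatorValue S := by
  obtain ⟨pre, suf, x, p, q, y, rfl, rfl⟩ := h
  have hw := weight_isolator_split x y p q
  simp only [toucherValue, isolatorValue, total_split, criticals_split, total_cons,
    criticals_cons]
  omega

theorem exists_split_isolatorValue_le {S : List Segment} (h : ∃ s ∈ S, s.length ≠ 0) :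
    ∃ S', Split false S S' ∧ isolatorValue S' ≤ toucherValue S := by
  -- If the number of critical segments is odd, a critical one is claimed; otherwise one hot enough
  -- to bring the total down to a multiple of 8 or below.
  have key : ∃ s ∈ S, s.length ≠ 0 ∧ (criticals S % 2 = 1 → s.critical = 1) ∧
      (criticals S % 2 = 0 → total S % 8 ≤ heat s.weight) := by
    by_cases h1 : criticals S % 2 = 1
    · obtain ⟨s, hs, hc⟩ := exists_critical h1
      exact ⟨s, hs, length_ne_zero_of_critical hc, fun _ => hc, by omega⟩
    · by_cases h2 : total S % 8 = 0
      · obtain ⟨s, hs, hl⟩ := h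
        exact ⟨s, hs, hl, by omega, by omega⟩
      · obtain ⟨s, hs, hl, ht, -⟩ := exists_heat h2
        exact ⟨s, hs, hl, by omega, fun _ => ht⟩
  obtain ⟨⟨x, l, y⟩, hs, hl, hc, ht⟩ := key
  obtain ⟨pre, suf, rfl⟩ := List.append_of_mem hs
  obtain ⟨p, q, rfl, hw, hw'⟩ := exists_toucher_split x y l hl
  refine ⟨_, ⟨pre, suf, x, p, q, y, rfl, rfl⟩, ?_⟩
  have h1 := critical_eq_zero (s := ⟨x, p, false⟩) (.inr rfl)
  have h2 := critical_eq_zero (s := ⟨false, q, y⟩) (.inl rfl)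
  have h3 := critical_le_one ⟨x, p + 1 + q, y⟩
  simp only [toucherValue, isolatorValue, total_split, criticals_split, total_cons,
    criticals_cons, h1, h2] at hc ht ⊢
  omega

theorem exists_split_le_toucherValue {S : List Segment} (h : ∃ s ∈ S, s.length ≠ 0) :
    ∃ S', Split true S S' ∧ isolatorValue S ≤ toucherValue S' := by
  have key : ∃ s ∈ S, s.length ≠ 0 ∧ (criticals S % 2 = 1 → s.critical = 1) ∧
      (criticals S % 2 = 0 → total S % 8 ≠ 0 → 8 ≤ total S % 8 + heat s.weight) := by
    by_cases h1 : criticals S % 2 = 1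
    · obtain ⟨s, hs, hc⟩ := exists_critical h1
      exact ⟨s, hs, length_ne_zero_of_critical hc, fun _ => hc, by omega⟩
    · by_cases h2 : total S % 8 = 0
      · obtain ⟨s, hs, hl⟩ := h
        exact ⟨s, hs, hl, by omega, by omega⟩
      · obtain ⟨s, hs, hl, -, ht⟩ := exists_heat h2
        exact ⟨s, hs, hl, by omega, fun _ _ => ht⟩
  obtain ⟨⟨x, l, y⟩, hs, hl, hc, ht⟩ := key
  obtain ⟨pre, suf, rfl⟩ := List.append_of_mem hs
  obtain ⟨p, q, rfl, hw, hw'⟩ := exists_isolator_split x y l hl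
  refine ⟨_, ⟨pre, suf, x, p, q, y, rfl, rfl⟩, ?_⟩
  have h3 := critical_le_one ⟨x, p + 1 + q, y⟩
  simp only [toucherValue, isolatorValue, total_split, criticals_split, total_cons,
    criticals_cons] at hc ht ⊢
  omega

/-- Without unclaimed cells the value is the score. -/
theorem total_eq_score {S : List Segment} (h : ∀ s ∈ S, s.length = 0) :
    total S = 8 * (S.map score).sum ∧ criticals S = 0 := by
  induction S with
  | nil => simp [total, criticals]
  | cons s S ih =>
    obtain ⟨h1, h2⟩ := ih fun t ht => h t (by simp [ht])
    have h3 := h s (by simp)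
    rw [total_cons, criticals_cons, h1, h2]
    rcases s with ⟨_ | _, _ | l, _ | _⟩ <;>
      simp_all [weight, critical, score, weightTT, weightTI, mul_add]

end Segment
-- Words of cells and their segments
namespace Segment

/-- The segments of a word of claimed (`some`) and unclaimed (`none`) cells with a claim of Toucher
after its end, where `l` unclaimed cells and before them a claim of `b` precede the word. -/
def scan : Bool → ℕ → List (Option Bool) → List Segment
  | b, l, [] => [⟨b, l, false⟩]
  | b, l, none :: w => scan b (l + 1) w
  | b, l, some c :: w => ⟨b, l, c⟩ :: scan c 0 w

/-- What precedes a word affects only the left border and length of its first segment; hence `q`,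
`y`, `suf` are chosen before `b` and `l`. -/
theorem scan_shape (w : List (Option Bool)) :
    ∃ q y suf, ∀ b l, scan b l w = ⟨b, l + q, y⟩ :: suf := by
  induction w with
  | nil => exact ⟨0, false, [], fun b l => rfl⟩
  | cons c w ih =>
    rcases c with _ | c
    · obtain ⟨q, y, suf, h⟩ := ih
      exact ⟨q + 1, y, suf, fun b l => by rw [scan, h, add_assoc, add_comm 1 q]⟩
    · exact ⟨0, c, scan c 0 w, fun b l => rfl⟩

theorem split_scan (c : Bool) (u v : List (Option Bool)) (b : Bool) (l : ℕ) :
    Split c (scan b l (u ++ none :: v)) (scan b l (u ++ some c :: v)) := by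
  induction u generalizing b l with
  | nil =>
    obtain ⟨q, y, suf, h⟩ := scan_shape v
    refine ⟨[], suf, b, l, q, y, ?_, ?_⟩
    · simp [scan, h]
    · simp [scan, h]
  | cons d u ih =>
    rcases d with _ | d
    · exact ih b (l + 1)
    · obtain ⟨pre, suf, x, p, q, y, h1, h2⟩ := ih d 0
      exact ⟨⟨b, l, d⟩ :: pre, suf, x, p, q, y, by simp [scan, h1], by simp [scan, h2]⟩

/-- Converse of `split_scan`. The condition `hp` keeps the claim off the `l` cells that precede `w`.
-/
theorem exists_of_scan_eq (c : Bool) (w : List (Option Bool)) (b : Bool) (l : ℕ)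
    {pre suf : List Segment} {x y : Bool} {p q : ℕ}
    (h : scan b l w = pre ++ ⟨x, p + 1 + q, y⟩ :: suf) (hp : pre = [] → l ≤ p) :
    ∃ u v, w = u ++ none :: v ∧
      scan b l (u ++ some c :: v) = pre ++ ⟨x, p, c⟩ :: ⟨c, q, y⟩ :: suf := by
  induction w generalizing b l pre with
  | nil =>
    rcases pre with _ | ⟨s, pre⟩
    · simp [scan] at h hp
      omega
    · simp [scan] at h
  | cons d w ih =>
    rcases d with _ | d
    · by_cases hpl : pre = [] ∧ p = l
      · obtain ⟨rfl, rfl⟩ := hpl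
        obtain ⟨q', y', suf', hw⟩ := scan_shape w
        refine ⟨[], w, rfl, ?_⟩
        simp only [scan, hw, List.nil_append, List.cons.injEq, mk.injEq] at h ⊢
        simp only [h, and_true, true_and]
        omega
      · obtain ⟨u, v, rfl, h'⟩ := ih b (l + 1) h (fun hn => by
          have := hp hn
          have : p ≠ l := fun he => hpl ⟨hn, he⟩
          omega)
        exact ⟨none :: u, v, rfl, h'⟩
    · rcases pre with _ | ⟨s, pre⟩
      · simp [scan] at h hp
        omega
      · simp only [scan, List.cons_append, List.cons.injEq] at h
        obtain ⟨rfl, h⟩ := h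
        obtain ⟨u, v, rfl, h'⟩ := ih d 0 h (by simp)
        exact ⟨some d :: u, v, rfl, by simp [scan, h']⟩

theorem Split.exists_scan {c : Bool} {w : List (Option Bool)} {b : Bool} {S : List Segment}
    (h : Split c (scan b 0 w) S) :
    ∃ u v, w = u ++ none :: v ∧ S = scan b 0 (u ++ some c :: v) := by
  obtain ⟨pre, suf, x, p, q, y, h1, rfl⟩ := h
  obtain ⟨u, v, rfl, h⟩ := exists_of_scan_eq c w b 0 h1 (by simp)
  exact ⟨u, v, rfl, h.symm⟩

theorem exists_length_ne_zero {w : List (Option Bool)} (h : none ∈ w) (b : Bool) (l : ℕ) :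
    ∃ s ∈ scan b l w, s.length ≠ 0 := by
  obtain ⟨u, v, rfl⟩ := List.append_of_mem h
  obtain ⟨pre, suf, x, p, q, y, h1, -⟩ := split_scan true u v b l
  exact ⟨⟨x, p + 1 + q, y⟩, by simp [h1], by simp⟩

theorem length_eq_zero {w : List (Option Bool)} (h : none ∉ w) (b : Bool) :
    ∀ s ∈ scan b 0 w, s.length = 0 := by
  induction w generalizing b with
  | nil => simp [scan]
  | cons c w ih =>
    rcases c with _ | c
    · simp at h
    · simp only [List.mem_cons, not_or] at h
      simpa [scan] using ih h.2 c

theorem scan_replicate_none (b : Bool) (l m : ℕ) :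
    scan b l (List.replicate m none) = [⟨b, l + m, false⟩] := by
  induction m generalizing l with
  | zero => rfl
  | succ m ih => simp [List.replicate_succ, scan, ih, add_assoc, add_comm 1 m]

/-- Index `i` is the gap after cell `s + i`. The gap `i = m` borders the closing Toucher claim and
cannot score, hence `i < m`. -/
theorem score_scan_range' (c : ℕ → Bool) (s m : ℕ) :
    ((scan (c s) 0 ((List.range' (s + 1) m).map fun i => some (c i))).map score).sum =
      ∑ i ∈ Finset.range (m + 1), if c (s + i) ∧ i < m ∧ c (s + i + 1) then 1 else 0 := by
  induction m generalizing s with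
  | zero => cases c s <;> simp [scan, score]
  | succ m ih =>
    rw [List.range'_succ, List.map_cons, scan, List.map_cons, List.sum_cons, ih,
      Finset.sum_range_succ' _ (m + 1), add_comm]
    congr 1
    · refine Finset.sum_congr rfl fun i _ => ?_
      simp [add_assoc, add_comm 1 i]
    · cases c s <;> cases c (s + 1) <;> simp [score]

end Segment

/-! ### Positions of the game as words -/

section Position

variable {E : Type*} [DecidableEq E]

/-- The state of an edge: claimed by Toucher, unclaimed, or claimed by Isolator. -/
def edgeState (T A : Finset E) (e : E) : Option Bool :=
  if e ∈ T then some false else if e ∈ A then none else some true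

theorem map_edgeState_toucher {T A : Finset E} {u v : List E} {e : E}
    (hn : (u ++ e :: v).Nodup) :
    (u ++ e :: v).map (edgeState (insert e T) (A.erase e)) =
      u.map (edgeState T A) ++ some false :: v.map (edgeState T A) := by
  have h (f : E) (hf : f ≠ e) : edgeState (insert e T) (A.erase e) f = edgeState T A f := by
    simp [edgeState, hf]
  rw [List.nodup_append] at hn
  rw [List.map_append, List.map_cons]
  congr 1
  · exact List.map_congr_left fun f hf => h f (hn.2.2 f hf e (by simp))
  · congr 1
    · simp [edgeState]
    · refine List.map_congr_left fun f hf => h f ?_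
      rintro rfl
      exact (List.nodup_cons.1 hn.2.1).1 hf

theorem map_edgeState_isolator {T A : Finset E} {u v : List E} {e : E}
    (hn : (u ++ e :: v).Nodup) (he : e ∉ T) :
    (u ++ e :: v).map (edgeState T (A.erase e)) =
      u.map (edgeState T A) ++ some true :: v.map (edgeState T A) := by
  have h (f : E) (hf : f ≠ e) : edgeState T (A.erase e) f = edgeState T A f := by
    simp [edgeState, hf]
  rw [List.nodup_append] at hn
  rw [List.map_append, List.map_cons]
  congr 1
  · exact List.map_congr_left fun f hf => h f (hn.2.2 f hf e (by simp))
  · congr 1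
    · simp [edgeState, he]
    · refine List.map_congr_left fun f hf => h f ?_
      rintro rfl
      exact (List.nodup_cons.1 hn.2.1).1 hf

theorem edgeState_of_mem {T A : Finset E} {e : E} (h : Disjoint T A) (he : e ∈ A) :
    edgeState T A e = none := by
  simp [edgeState, he, Finset.disjoint_right.1 h he]

theorem edgeState_eq_none {T A : Finset E} {e : E} (h : edgeState T A e = none) :
    e ∈ A ∧ e ∉ T := by
  unfold edgeState at h
  split_ifs at h
  simp_all

/-- The segments of a position whose edges are listed in `L`. -/
def positionSegments (L : List E) (T A : Finset E) : List Segment :=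
  Segment.scan false 0 (L.map (edgeState T A))

open Segment

theorem split_toucher {L : List E} (hL : L.Nodup) {T A : Finset E} (hd : Disjoint T A)
    {e : E} (he : e ∈ A) (heL : e ∈ L) :
    Split false (positionSegments L T A) (positionSegments L (insert e T) (A.erase e)) := by
  obtain ⟨u, v, rfl⟩ := List.append_of_mem heL
  rw [positionSegments, positionSegments, map_edgeState_toucher hL, List.map_append,
    List.map_cons, edgeState_of_mem hd he]
  exact split_scan _ _ _ _ _

theorem split_isolator {L : List E} (hL : L.Nodup) {T A : Finset E} (hd : Disjoint T A)
    {e : E} (he : e ∈ A) (heL : e ∈ L) :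
    Split true (positionSegments L T A) (positionSegments L T (A.erase e)) := by
  obtain ⟨u, v, rfl⟩ := List.append_of_mem heL
  rw [positionSegments, positionSegments,
    map_edgeState_isolator hL (Finset.disjoint_right.1 hd he), List.map_append,
    List.map_cons, edgeState_of_mem hd he]
  exact split_scan _ _ _ _ _

theorem exists_edge_of_split_toucher {L : List E} (hL : L.Nodup) {T A : Finset E}
    {S : List Segment} (h : Split false (positionSegments L T A) S) :
    ∃ e ∈ A, S = positionSegments L (insert e T) (A.erase e) := by
  obtain ⟨u, v, hw, rfl⟩ := h.exists_scan
  obtain ⟨u, v', rfl, rfl, hv⟩ := List.map_eq_append_iff.1 hw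
  obtain ⟨e, v, rfl, he, rfl⟩ := List.map_eq_cons_iff.1 hv
  exact ⟨e, (edgeState_eq_none he).1, by rw [positionSegments, map_edgeState_toucher hL]⟩

theorem exists_edge_of_split_isolator {L : List E} (hL : L.Nodup) {T A : Finset E}
    {S : List Segment} (h : Split true (positionSegments L T A) S) :
    ∃ e ∈ A, S = positionSegments L T (A.erase e) := by
  obtain ⟨u, v, hw, rfl⟩ := h.exists_scan
  obtain ⟨u, v', rfl, rfl, hv⟩ := List.map_eq_append_iff.1 hw
  obtain ⟨e, v, rfl, he, rfl⟩ := List.map_eq_cons_iff.1 hv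
  exact ⟨e, (edgeState_eq_none he).1, by
    rw [positionSegments, map_edgeState_isolator hL (edgeState_eq_none he).2]⟩

theorem exists_segment_length_ne_zero {L : List E} {T A : Finset E} (hd : Disjoint T A)
    (hA : A.Nonempty) (hAL : ∀ e ∈ A, e ∈ L) :
    ∃ s ∈ positionSegments L T A, s.length ≠ 0 := by
  obtain ⟨e, he⟩ := hA
  exact exists_length_ne_zero (List.mem_map.2 ⟨e, hAL e he, edgeState_of_mem hd he⟩) _ _

theorem total_positionSegments_empty (L : List E) (T : Finset E) :
    total (positionSegments L T ∅) = 8 * ((positionSegments L T ∅).map score).sum ∧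
      criticals (positionSegments L T ∅) = 0 := by
  refine total_eq_score (length_eq_zero ?_ _)
  intro h
  obtain ⟨e, -, he⟩ := List.mem_map.1 h
  simpa using (edgeState_eq_none he).1

end Position

/-! ### The minimax value -/

section Value

open Segment

variable {V : Type*} [Fintype V] [DecidableEq V]

/-- The value of a position in which the edges of `L` lie consecutively on a line between claims of
Toucher. -/
theorem positionValue_eq {L : List (Sym2 V)} (hL : L.Nodup) (e₀ : Sym2 V)
    (hend : ∀ T : Finset (Sym2 V), e₀ ∈ T → (∀ e ∈ T, e = e₀ ∨ e ∈ L) →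
      (untouchedVertices T).card = ((positionSegments L T ∅).map score).sum)
    (T A : Finset (Sym2 V)) (hd : Disjoint T A) (he₀ : e₀ ∈ T) (hT : ∀ e ∈ T, e = e₀ ∨ e ∈ L)
    (hA : ∀ e ∈ A, e ∈ L) :
    positionValue .toucher T A = toucherValue (positionSegments L T A) ∧
      positionValue .isolator T A = isolatorValue (positionSegments L T A) := by
  induction h : A.card generalizing T A with
  | zero =>
    obtain rfl := Finset.card_eq_zero.1 h
    obtain ⟨h1, h2⟩ := total_positionSegments_empty L T
    rw [positionValue, positionValue, dif_neg (by simp), dif_neg (by simp), toucherValue,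
      isolatorValue, h1, h2, hend T he₀ hT]
    omega
  | succ k ih =>
    have hne : A.Nonempty := Finset.card_pos.1 (by omega)
    have htouch (e : Sym2 V) (he : e ∈ A) : positionValue .isolator (insert e T) (A.erase e) =
        isolatorValue (positionSegments L (insert e T) (A.erase e)) := by
      refine (ih (insert e T) (A.erase e) ?_ (by simp [he₀]) ?_ ?_ ?_).2
      · rw [Finset.disjoint_left] at hd ⊢
        intro f hf hf'
        rcases Finset.mem_insert.1 hf with rfl | hf
        · simp at hf'
        · exact hd hf (Finset.mem_of_mem_erase hf')
      · intro f hf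
        rcases Finset.mem_insert.1 hf with rfl | hf
        · exact .inr (hA _ he)
        · exact hT f hf
      · exact fun f hf => hA f (Finset.mem_of_mem_erase hf)
      · rw [Finset.card_erase_of_mem he, h, Nat.add_sub_cancel]
    have hisol (e : Sym2 V) (he : e ∈ A) : positionValue .toucher T (A.erase e) =
        toucherValue (positionSegments L T (A.erase e)) := by
      refine (ih T (A.erase e) ?_ he₀ hT ?_ ?_).1
      · exact hd.mono_right (Finset.erase_subset _ _)
      · exact fun f hf => hA f (Finset.mem_of_mem_erase hf)
      · rw [Finset.card_erase_of_mem he, h, Nat.add_sub_cancel]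
    have hlen := exists_segment_length_ne_zero hd hne hA
    constructor
    · rw [positionValue, dif_pos hne]
      apply le_antisymm
      · obtain ⟨S, hS, hle⟩ := exists_split_isolatorValue_le hlen
        obtain ⟨e, he, rfl⟩ := exists_edge_of_split_toucher hL hS
        rw [← htouch e he] at hle
        exact (Finset.inf'_le _ (Finset.mem_attach A ⟨e, he⟩)).trans hle
      · refine Finset.le_inf' _ _ fun e _ => ?_
        rw [htouch e.1 e.2]
        exact (split_toucher hL hd e.2 (hA _ e.2)).toucherValue_le
    · rw [positionValue, dif_pos hne]
      apply le_antisymm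
      · refine Finset.sup'_le _ _ fun e _ => ?_
        rw [hisol e.1 e.2]
        exact (split_isolator hL hd e.2 (hA _ e.2)).toucherValue_le_isolatorValue
      · obtain ⟨S, hS, hle⟩ := exists_split_le_toucherValue hlen
        obtain ⟨e, he, rfl⟩ := exists_edge_of_split_isolator hL hS
        rw [← hisol e he] at hle
        exact hle.trans (Finset.le_sup' (f := fun e : {x // x ∈ A} =>
          positionValue .toucher T (A.erase e.1)) (Finset.mem_attach A ⟨e, he⟩))

end Value
-- The cycle, cut open at Toucher's first edge
section Cycle

open Fin.NatCast Fin.CommRing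

variable {k : ℕ}

/-- The edge from the vertex `i` of the cycle to the next vertex. -/
def cycleEdge (k i : ℕ) : Sym2 (Fin (k + 3)) := s((i : Fin (k + 3)), ((i + 1 : ℕ) : Fin (k + 3)))

theorem natCast_eq_iff {a b : ℕ} : (a : Fin (k + 3)) = b ↔ a ≡ b [MOD k + 3] := by
  rw [Fin.ext_iff, Fin.val_natCast, Fin.val_natCast, Nat.ModEq]

theorem mem_cycleEdge {a b : ℕ} : ((a + 1 : ℕ) : Fin (k + 3)) ∈ cycleEdge k b ↔
    a ≡ b [MOD k + 3] ∨ a + 1 ≡ b [MOD k + 3] := by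
  rw [cycleEdge, Sym2.mem_iff, natCast_eq_iff, natCast_eq_iff, or_comm]
  exact or_congr_left ⟨Nat.ModEq.add_right_cancel' 1, Nat.ModEq.add_right 1⟩

theorem cycleEdge_eq_of_modEq {a b : ℕ} (h : a ≡ b [MOD k + 3]) :
    cycleEdge k a = cycleEdge k b := by
  rw [cycleEdge, cycleEdge, natCast_eq_iff.2 h, natCast_eq_iff.2 (h.add_right 1)]

theorem cycleEdge_eq_iff {a b : ℕ} : cycleEdge k a = cycleEdge k b ↔ a ≡ b [MOD k + 3] := by
  refine ⟨fun h => ?_, cycleEdge_eq_of_modEq⟩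
  rw [cycleEdge, cycleEdge, Sym2.eq_iff, natCast_eq_iff, natCast_eq_iff, natCast_eq_iff,
    natCast_eq_iff] at h
  rcases h with h | ⟨h1, h2⟩
  · exact h.1
  · have h3 : a + 2 ≡ a + 0 [MOD k + 3] := (h2.add_right 1).trans h1.symm
    have h4 := Nat.ModEq.add_left_cancel' a h3
    rw [Nat.ModEq, Nat.mod_eq_of_lt (by omega), Nat.zero_mod] at h4
    omega

theorem mem_edgeFinset_cycleGraph {e : Sym2 (Fin (k + 3))} :
    e ∈ (SimpleGraph.cycleGraph (k + 3)).edgeFinset ↔ ∃ a, e = cycleEdge k a := by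
  rw [SimpleGraph.mem_edgeFinset]
  induction e with
  | _ x y =>
    have hsucc (z : Fin (k + 3)) : z + 1 = ((z.val + 1 : ℕ) : Fin (k + 3)) := by simp
    rw [SimpleGraph.mem_edgeSet, SimpleGraph.cycleGraph_adj]
    constructor
    · rintro (h | h)
      · refine ⟨y.val, ?_⟩
        obtain rfl : x = y + 1 := by rw [← h]; ring
        rw [cycleEdge, ← hsucc, Fin.cast_val_eq_self, Sym2.eq_swap]
      · refine ⟨x.val, ?_⟩
        obtain rfl : y = x + 1 := by rw [← h]; ring
        rw [cycleEdge, ← hsucc, Fin.cast_val_eq_self]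
    · rintro ⟨a, h⟩
      rw [cycleEdge, Sym2.eq_iff] at h
      rcases h with ⟨rfl, rfl⟩ | ⟨rfl, rfl⟩
      · right; push_cast; ring
      · left; push_cast; ring

/-- The edges of the cycle other than `cycleEdge k j`, in their order on the cycle. -/
def otherEdges (k j : ℕ) : List (Sym2 (Fin (k + 3))) :=
  (List.range' (j + 1) (k + 2)).map (cycleEdge k)

theorem eq_of_modEq_of_le {j a b : ℕ} (h : a ≡ b [MOD k + 3]) (ha : j ≤ a) (ha' : a < j + (k + 3))
    (hb : j ≤ b) (hb' : b < j + (k + 3)) : a = b := by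
  obtain ⟨a, rfl⟩ := Nat.exists_eq_add_of_le ha
  obtain ⟨b, rfl⟩ := Nat.exists_eq_add_of_le hb
  rw [Nat.ModEq.eq_of_lt_of_lt (Nat.ModEq.add_left_cancel' j h) (by omega) (by omega)]

theorem nodup_otherEdges (j : ℕ) : (otherEdges k j).Nodup := by
  refine List.Nodup.map_on ?_ List.nodup_range'
  intro a ha b hb h
  rw [List.mem_range'_1] at ha hb
  exact eq_of_modEq_of_le (j := j) (cycleEdge_eq_iff.1 h) (by omega) (by omega) (by omega)
    (by omega)

theorem not_mem_otherEdges (j : ℕ) : cycleEdge k j ∉ otherEdges k j := by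
  intro h
  obtain ⟨a, ha, h⟩ := List.mem_map.1 h
  rw [List.mem_range'_1] at ha
  have := eq_of_modEq_of_le (j := j) (cycleEdge_eq_iff.1 h) (by omega) (by omega) (by omega)
    (by omega)
  omega

theorem cycleEdge_eq_or_mem (j a : ℕ) :
    cycleEdge k a = cycleEdge k j ∨ cycleEdge k a ∈ otherEdges k j := by
  have hex : ∃ b, b < k + 3 ∧ a ≡ j + b [MOD k + 3] := by
    -- This is `a - j` modulo `k + 3`, since `k + 2` is congruent to -1.
    refine ⟨(a + (k + 2) * j) % (k + 3), Nat.mod_lt _ (by omega), ?_⟩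
    refine Nat.ModEq.trans ?_ ((Nat.mod_modEq _ _).symm.add_left j)
    rw [show j + (a + (k + 2) * j) = a + (k + 3) * j by ring]
    simp [Nat.ModEq]
  obtain ⟨b, hb, hab⟩ := hex
  rcases Nat.eq_zero_or_pos b with rfl | hb0
  · exact .inl (cycleEdge_eq_of_modEq hab)
  · exact .inr (List.mem_map.2 ⟨j + b, by rw [List.mem_range'_1]; omega,
      (cycleEdge_eq_of_modEq hab).symm⟩)

theorem untouched_iff {T : Finset (Sym2 (Fin (k + 3)))} (hT : ∀ e ∈ T, ∃ a, e = cycleEdge k a)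
    (a : ℕ) : (∀ e ∈ T, ((a + 1 : ℕ) : Fin (k + 3)) ∉ e) ↔
      cycleEdge k a ∉ T ∧ cycleEdge k (a + 1) ∉ T := by
  constructor
  · exact fun h => ⟨fun he => h _ he (mem_cycleEdge.2 (.inl rfl)),
      fun he => h _ he (mem_cycleEdge.2 (.inr rfl))⟩
  · rintro ⟨h1, h2⟩ e he hm
    obtain ⟨b, rfl⟩ := hT e he
    rcases mem_cycleEdge.1 hm with h | h
    · exact h1 (cycleEdge_eq_of_modEq h ▸ he)
    · exact h2 (cycleEdge_eq_of_modEq h ▸ he)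

open Segment in
theorem card_untouchedVertices {j : ℕ} {T : Finset (Sym2 (Fin (k + 3)))}
    (hj : cycleEdge k j ∈ T) (hT : ∀ e ∈ T, ∃ a, e = cycleEdge k a) :
    (untouchedVertices T).card = ((positionSegments (otherEdges k j) T ∅).map score).sum := by
  let c : ℕ → Bool := fun i => decide (cycleEdge k i ∉ T)
  have hword : (otherEdges k j).map (edgeState T ∅) =
      (List.range' (j + 1) (k + 2)).map fun i => some (c i) := by
    rw [otherEdges, List.map_map]
    refine List.map_congr_left fun i _ => ?_
    by_cases h : cycleEdge k i ∈ T <;> simp [edgeState, c, h]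
  have hcj : c j = false := by simp [c, hj]
  have hscore := score_scan_range' c j (k + 2)
  rw [hcj] at hscore
  rw [positionSegments, hword, hscore, untouchedVertices, Finset.card_filter, Finset.sum_range]
  symm
  -- The gap after edge `j + i` is the vertex `j + i + 1`.
  refine Fintype.sum_equiv (Equiv.addLeft ((j + 1 : ℕ) : Fin (k + 3))) _ _ fun i => ?_
  have hcast : Equiv.addLeft ((j + 1 : ℕ) : Fin (k + 3)) i =
      ((j + i.val + 1 : ℕ) : Fin (k + 3)) := by
    simp only [Equiv.coe_addLeft]
    push_cast
    ring
  rw [hcast]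
  refine if_congr ?_ rfl rfl
  rw [untouched_iff hT]
  simp only [c, decide_eq_true_eq]
  refine and_congr_right fun _ => ⟨And.right, fun h => ⟨?_, h⟩⟩
  -- The last gap closes the cycle: the edge after it is `cycleEdge k j` again, which Toucher holds.
  by_contra hi
  have hi' : i.val = k + 2 := by omega
  refine h ?_
  rwa [hi', show j + (k + 2) + 1 = j + (k + 3) by omega,
    cycleEdge_eq_of_modEq (b := j) (by simp [Nat.ModEq])]

open Segment in
theorem positionValue_isolator_cycleGraph (j : ℕ) :
    positionValue .isolator {cycleEdge k j}
      ((SimpleGraph.cycleGraph (k + 3)).edgeFinset.erase (cycleEdge k j)) = (k + 3 + 1) / 5 := by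
  have hA : ∀ e ∈ (SimpleGraph.cycleGraph (k + 3)).edgeFinset.erase (cycleEdge k j),
      e ∈ otherEdges k j := by
    intro e he
    rw [Finset.mem_erase, mem_edgeFinset_cycleGraph] at he
    obtain ⟨hne, a, rfl⟩ := he
    exact (cycleEdge_eq_or_mem j a).resolve_left hne
  have hvalue := (positionValue_eq (nodup_otherEdges j) (cycleEdge k j)
    (fun T hj hT => card_untouchedVertices hj fun e he => ?_) {cycleEdge k j}
    ((SimpleGraph.cycleGraph (k + 3)).edgeFinset.erase (cycleEdge k j)) (by simp) (by simp)
    (by simp) hA).2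
  · have hword : (otherEdges k j).map (edgeState {cycleEdge k j}
        ((SimpleGraph.cycleGraph (k + 3)).edgeFinset.erase (cycleEdge k j))) =
        List.replicate (k + 2) none := by
      rw [List.eq_replicate_iff]
      refine ⟨by simp [otherEdges], ?_⟩
      intro s hs
      obtain ⟨e, he, rfl⟩ := List.mem_map.1 hs
      have hne : e ≠ cycleEdge k j := fun h => not_mem_otherEdges j (h ▸ he)
      refine edgeState_of_mem (by simp) (Finset.mem_erase.2 ⟨hne, ?_⟩)
      obtain ⟨a, -, rfl⟩ := List.mem_map.1 he
      exact mem_edgeFinset_cycleGraph.2 ⟨a, rfl⟩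
    rw [hvalue, positionSegments, hword, scan_replicate_none, isolatorValue]
    simp only [total, criticals, List.map_cons, List.map_nil, List.sum_cons, List.sum_nil, weight,
      critical_eq_zero (s := ⟨false, _, _⟩) (.inl rfl), weightTT]
    omega
  · rcases hT e he with rfl | h
    · exact ⟨j, rfl⟩
    · obtain ⟨a, -, rfl⟩ := List.mem_map.1 h
      exact ⟨a, rfl⟩

end Cycle

theorem theorem1 (n : ℕ) (hn : 3 ≤ n) :
    untouchedNumber (SimpleGraph.cycleGraph n) = (n + 1) / 5 := by
  obtain ⟨k, rfl⟩ : ∃ k, n = k + 3 := ⟨n - 3, by omega⟩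
  have hvalue (e) (he : e ∈ (SimpleGraph.cycleGraph (k + 3)).edgeFinset) :
      positionValue .isolator (insert e ∅) ((SimpleGraph.cycleGraph (k + 3)).edgeFinset.erase e) =
        (k + 3 + 1) / 5 := by
    obtain ⟨j, rfl⟩ := mem_edgeFinset_cycleGraph.1 he
    exact positionValue_isolator_cycleGraph j
  have hne : (SimpleGraph.cycleGraph (k + 3)).edgeFinset.Nonempty :=
    ⟨_, mem_edgeFinset_cycleGraph.2 ⟨0, rfl⟩⟩
  rw [untouchedNumber, positionValue, dif_pos hne]
  apply le_antisymm
  · obtain ⟨e, he⟩ := hne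
    exact (Finset.inf'_le _ (Finset.mem_attach _ ⟨e, he⟩)).trans (hvalue e he).le
  · exact Finset.le_inf' _ _ fun e _ => (hvalue e.1 e.2).ge
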